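/- Let $G$ be a countable abelian group (written multiplicatively) acting on a probability space $(X,\mathcal B,\mu)$ by measure-preserving transformations, that is, for each $g\in G$ the map $x\mapsto g.x$ is measurable and $\mu(gB)=\mu(B)$ for every $B\in\mathcal B$. Suppose that $L^2(X,\mathcal B,\mu)$ is separable. For $A\subset G$ and $B\in\mathcal B$ with $\mu(B)>0$, write $AB=\{a.x : a\in A,\ x\in B\}$ and define the magnification ratio $$c(A,B)=\inf\left\{\frac{\mu(AB')}{\mu(B')} : B'\subset B,\ B'\in\mathcal B,\ \mu(B')>0\right\}.$$ For a positive integer $k$ write $A^k=\{a_1a_2\cdots a_k : a_1,\dots,a_k\in A\}$. Then for every (not necessarily finite) set $A\subset G$, every $B\in\mathcal B$ with $\mu(B)>0$, and all positive integers $j\le k$, $$c(A^k,B)^{1/k}\le c(A^j,B)^{1/j}\le\left(\frac{\mu(A^jB)}{\mu(B)}\right)^{1/j}.$$ -/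

import Mathlib

open MeasureTheory
open scoped Pointwise ENNReal

/-- The magnification ratio `c(A, B)`, the infimum of `μ (A B') / μ B'` over the measurable
subsets `B'` of `B` of positive measure. It is a value in `[0, ∞]`; for `μ B` positive and finite
every quotient below has a positive finite denominator and the infimum is over a nonempty family. -/
noncomputable def magnificationRatio {G X : Type*} [SMul G X] [MeasurableSpace X]
    (μ : Measure X) (A : Set G) (B : Set X) : ℝ≥0∞ :=
  ⨅ (B' : Set X) (_ : MeasurableSet B') (_ : B' ⊆ B) (_ : 0 < μ B'), μ (A • B') / μ B'

/-! Join `x` to `a • x` across the layers `B, A • B, A ^ 2 • B, …`, weight layer `i` by `D ^ i`, and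
look for a cheapest cut. Cutting all of layer `j` costs `D ^ j * μ (A ^ j • B)`, so the inequality
follows once every cut costs at least `μ B`. A minimal cut exists because `cutWeight` is submodular
and suitably semicontinuous. By `cutWeight_fill_le` the cut can be pushed out of the intermediate
layers at no cost, leaving only layers `0` and `k`, where the hypothesis `μ Z ≤ D ^ k * μ (A ^ k •
Z)` bounds it below by `μ B`. Pushing relies on commutativity, through
`mul_measureReal_smul_sdiff_le`. Finally `D = c ^ (-1 / k)`, with `c` the ratio for `A ^ k`, turns
this into the statement on magnification ratios. -/

/-- A submodular function on a complete lattice which is lower semicontinuous along monotone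
sequences attains its minimum over a sublattice closed under monotone sequential limits. -/
theorem exists_isMinOn_of_submodular {L : Type*} [CompleteLattice L] (P : L → Prop) (W : L → ℝ)
    (hne : ∃ x, P x) (hW0 : ∀ x, 0 ≤ W x)
    (hsup : ∀ x y, P x → P y → P (x ⊔ y)) (hinf : ∀ x y, P x → P y → P (x ⊓ y))
    (hiSup : ∀ u : ℕ → L, (∀ n, P (u n)) → P (⨆ n, u n))
    (hiInf : ∀ u : ℕ → L, (∀ n, P (u n)) → P (⨅ n, u n))
    (hsub : ∀ x y, P x → P y → W (x ⊔ y) + W (x ⊓ y) ≤ W x + W y)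
    (hmono : ∀ (u : ℕ → L) (c : ℝ), (∀ n, P (u n)) → Monotone u → (∀ n, W (u n) ≤ c) →
      W (⨆ n, u n) ≤ c)
    (hanti : ∀ (u : ℕ → L) (c : ℝ), (∀ n, P (u n)) → Antitone u → (∀ n, W (u n) ≤ c) →
      W (⨅ n, u n) ≤ c) :
    ∃ x, P x ∧ ∀ y, P y → W x ≤ W y := by
  set I : ℝ := sInf (W '' {x | P x}) with hI
  have hbdd : BddBelow (W '' {x | P x}) := ⟨0, by rintro _ ⟨x, -, rfl⟩; exact hW0 x⟩
  have hIle : ∀ y, P y → I ≤ W y := fun y hy => csInf_le hbdd ⟨y, hy, rfl⟩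
  have hex : ∀ n : ℕ, ∃ x, P x ∧ W x ≤ I + (1 / 2) ^ n := by
    intro n
    obtain ⟨_, ⟨x, hx, rfl⟩, hlt⟩ := exists_lt_of_csInf_lt
      (s := W '' {x | P x}) (b := I + (1 / 2) ^ n) (by
        obtain ⟨x, hx⟩ := hne
        exact ⟨W x, x, hx, rfl⟩) (lt_add_of_pos_right _ (by positivity))
    exact ⟨x, hx, hlt.le⟩
  choose r hrP hrW using hex
  -- Since the meet has weight at least `I`, submodularity makes the excesses over `I` add under
  -- joins; the bound is the sum of `(1 / 2) ^ i` for `n ≤ i ≤ n + m`.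
  have hV : ∀ n m : ℕ, P (partialSups (fun i => r (n + i)) m) ∧
      W (partialSups (fun i => r (n + i)) m) ≤ I + 2 * (1 / 2) ^ n - (1 / 2) ^ (n + m) := by
    intro n m
    induction m with
    | zero =>
      simp only [partialSups_zero, add_zero]
      exact ⟨hrP n, by linarith [hrW n]⟩
    | succ m ih =>
      rw [partialSups_add_one]
      refine ⟨hsup _ _ ih.1 (hrP _), ?_⟩
      have h1 := hsub _ _ ih.1 (hrP (n + (m + 1)))
      have h2 := hIle _ (hinf _ _ ih.1 (hrP (n + (m + 1))))
      have h3 := hrW (n + (m + 1))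
      have h4 : ((1 : ℝ) / 2) ^ (n + m) = 2 * (1 / 2) ^ (n + (m + 1)) := by
        rw [← add_assoc, pow_succ]; ring
      linarith [ih.2]
  have hU : ∀ n : ℕ, P (⨆ i, r (n + i)) ∧ W (⨆ i, r (n + i)) ≤ I + 2 * (1 / 2) ^ n := by
    intro n
    refine ⟨hiSup _ fun i => hrP _, ?_⟩
    rw [← iSup_partialSups_eq]
    refine hmono _ _ (fun m => (hV n m).1) (partialSups _).monotone fun m => ?_
    have : (0 : ℝ) < (1 / 2) ^ (n + m) := by positivity
    linarith [(hV n m).2]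
  have hUanti : Antitone fun n => ⨆ i, r (n + i) := by
    intro n m hnm
    refine iSup_le fun i => ?_
    refine le_iSup_of_le (m - n + i) (le_of_eq ?_)
    congr 1
    omega
  -- The minimiser is the limsup of near-minimisers.
  refine ⟨⨅ n, ⨆ i, r (n + i), hiInf _ fun n => (hU n).1, fun y hy => ?_⟩
  refine le_trans ?_ (hIle y hy)
  have key : ∀ N : ℕ, W (⨅ n, ⨆ i, r (n + i)) ≤ I + 2 * (1 / 2) ^ N := by
    intro N
    have hshift : (⨅ n, ⨆ i, r (n + i)) = ⨅ n, ⨆ i, r (n + N + i) :=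
      (hUanti.iInf_nat_add N).symm
    rw [hshift]
    refine hanti (fun n => ⨆ i, r (n + N + i)) _ (fun n => (hU _).1)
      (fun a b hab => hUanti (Nat.add_le_add_right hab N)) fun n => (hU _).2.trans ?_
    have : ((1 : ℝ) / 2) ^ (n + N) ≤ (1 / 2) ^ N :=
      pow_le_pow_of_le_one (by norm_num) (by norm_num) (Nat.le_add_left _ _)
    linarith
  have ht : Filter.Tendsto (fun N : ℕ => I + 2 * ((1 : ℝ) / 2) ^ N) Filter.atTop (nhds I) := by
    have := (tendsto_pow_atTop_nhds_zero_of_lt_one (r := (1 : ℝ) / 2) (by norm_num)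
      (by norm_num)).const_mul 2 |>.const_add I
    simpa using this
  exact ge_of_tendsto' ht key

/-! ### Chains of sets and minimal cuts -/

section Chains

variable {G X : Type*} [CommGroup G] [MulAction G X]

/-- The set `B` for `i = 0`, and the `A`-translates of the previous member `R (i - 1)` of the
chain otherwise. -/
def chainImage (A : Set G) (B : Set X) (R : ℕ → Set X) : ℕ → Set X
  | 0 => B
  | i + 1 => A • R i

theorem chainImage_mono {A : Set G} {B : Set X} {R R' : ℕ → Set X} (h : R ≤ R') (i : ℕ) :
    chainImage A B R i ⊆ chainImage A B R' i := by
  cases i with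
  | zero => exact subset_rfl
  | succ i => exact Set.smul_subset_smul_left (h i)

theorem chainImage_sup (A : Set G) (B : Set X) (R R' : ℕ → Set X) (i : ℕ) :
    chainImage A B (R ⊔ R') i = chainImage A B R i ∪ chainImage A B R' i := by
  cases i with
  | zero => exact (Set.union_self B).symm
  | succ i => exact Set.smul_union

theorem chainImage_iSup (A : Set G) (B : Set X) (u : ℕ → ℕ → Set X) (i : ℕ) :
    chainImage A B (⨆ n, u n) i = ⋃ n, chainImage A B (u n) i := by
  cases i with
  | zero => exact (Set.iUnion_const B).symm
  | succ i => simp [chainImage, Set.smul_iUnion]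

theorem chainImage_update_of_ne (A : Set G) (B : Set X) (R : ℕ → Set X) {m i : ℕ} (Q : Set X)
    (h : i ≠ m + 1) : chainImage A B (Function.update R m Q) i = chainImage A B R i := by
  cases i with
  | zero => rfl
  | succ i =>
    have : i ≠ m := by omega
    simp [chainImage, this]

variable [MeasurableSpace X]

theorem measurableSet_smul_of_countable [Countable G] [MeasurableConstSMul G X] (A : Set G)
    {R : Set X} (hR : MeasurableSet R) : MeasurableSet (A • R) := by
  rw [← Set.iUnion_smul_set]
  exact MeasurableSet.biUnion A.to_countable fun a _ => hR.const_smul a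

/-- The weight, with geometric weights `D ^ i`, of the vertex cut of the layered graph on
`B, A • B, A ^ 2 • B, …` whose reachable sets are the `R i`. -/
noncomputable def cutWeight (μ : Measure X) (A : Set G) (B : Set X) (D : ℝ) (k : ℕ)
    (R : ℕ → Set X) : ℝ :=
  ∑ i ∈ Finset.range (k + 1), D ^ i * μ.real (chainImage A B R i \ R i)

/-- Chains of measurable sets that are empty from the `k`-th member on. -/
def IsCutChain (k : ℕ) (R : ℕ → Set X) : Prop :=
  (∀ i, MeasurableSet (R i)) ∧ ∀ i, k ≤ i → R i = ∅

theorem measurableSet_chainImage [Countable G] [MeasurableConstSMul G X] (A : Set G) {B : Set X}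
    (hB : MeasurableSet B) {R : ℕ → Set X} (hR : ∀ i, MeasurableSet (R i)) (i : ℕ) :
    MeasurableSet (chainImage A B R i) := by
  cases i with
  | zero => exact hB
  | succ i => exact measurableSet_smul_of_countable A (hR i)

theorem cutWeight_nonneg (μ : Measure X) (A : Set G) (B : Set X) {D : ℝ} (hD : 0 ≤ D) (k : ℕ)
    (R : ℕ → Set X) : 0 ≤ cutWeight μ A B D k R :=
  Finset.sum_nonneg fun _ _ => by positivity

theorem measureReal_sdiff_submodular (μ : Measure X) [IsFiniteMeasure μ] {E E' F F' : Set X}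
    (hE : MeasurableSet E) (hF : MeasurableSet F) (hE' : MeasurableSet E')
    (hF' : MeasurableSet F') :
    μ.real ((E ∪ E') \ (F ∪ F')) + μ.real ((E ∩ E') \ (F ∩ F'))
      ≤ μ.real (E \ F) + μ.real (E' \ F') := by
  rw [← measureReal_union_add_inter (μ := μ) (s := E \ F) (hE'.diff hF'),
    ← measureReal_union_add_inter (s := (E ∪ E') \ (F ∪ F'))
      ((hE.inter hE').diff (hF.inter hF'))]
  refine add_le_add (measureReal_mono ?_) (measureReal_mono ?_)
  · intro x hx
    simp only [Set.mem_union, Set.mem_sdiff, Set.mem_inter_iff] at hx ⊢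
    tauto
  · intro x hx
    simp only [Set.mem_union, Set.mem_sdiff, Set.mem_inter_iff] at hx ⊢
    tauto

/-- Taking images commutes with unions and sends an intersection into the intersection of the
images, so each layer reduces to `measureReal_sdiff_submodular`. -/
theorem cutWeight_submodular [Countable G] [MeasurableConstSMul G X] (μ : Measure X)
    [IsFiniteMeasure μ] (A : Set G) {B : Set X} (hB : MeasurableSet B) {D : ℝ} (hD : 0 ≤ D)
    (k : ℕ) {R R' : ℕ → Set X} (hR : ∀ i, MeasurableSet (R i)) (hR' : ∀ i, MeasurableSet (R' i)) :
    cutWeight μ A B D k (R ⊔ R') + cutWeight μ A B D k (R ⊓ R')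
      ≤ cutWeight μ A B D k R + cutWeight μ A B D k R' := by
  unfold cutWeight
  rw [← Finset.sum_add_distrib, ← Finset.sum_add_distrib]
  refine Finset.sum_le_sum fun i _ => ?_
  rw [← mul_add, ← mul_add]
  refine mul_le_mul_of_nonneg_left ?_ (by positivity)
  refine le_trans ?_ (measureReal_sdiff_submodular μ (measurableSet_chainImage A hB hR i) (hR i)
    (measurableSet_chainImage A hB hR' i) (hR' i))
  rw [chainImage_sup]
  refine add_le_add le_rfl (measureReal_mono ?_)
  exact Set.sdiff_subset_sdiff_left (Set.subset_inter (chainImage_mono inf_le_left i)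
    (chainImage_mono inf_le_right i))

theorem tendsto_measureReal_iUnion_sdiff (μ : Measure X) [IsFiniteMeasure μ] {u : ℕ → Set X}
    (hu : Monotone u) (hm : ∀ n, MeasurableSet (u n)) :
    Filter.Tendsto (fun n => μ.real ((⋃ m, u m) \ u n)) Filter.atTop (nhds 0) := by
  have h : Filter.Tendsto (fun n => μ.real (⋃ m, u m) - μ.real (u n)) Filter.atTop
      (nhds (μ.real (⋃ m, u m) - μ.real (⋃ m, u m))) :=
    tendsto_const_nhds.sub ((ENNReal.tendsto_toReal (measure_ne_top _ _)).comp
      (tendsto_measure_iUnion_atTop hu))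
  rw [sub_self] at h
  refine h.congr fun n => ?_
  rw [measureReal_sdiff (Set.subset_iUnion u n) (hm n)]

theorem tendsto_measureReal_sdiff_iInter (μ : Measure X) [IsFiniteMeasure μ] {u : ℕ → Set X}
    (hu : Antitone u) (hm : ∀ n, MeasurableSet (u n)) :
    Filter.Tendsto (fun n => μ.real (u n \ ⋂ m, u m)) Filter.atTop (nhds 0) := by
  have h := tendsto_measureReal_iUnion_sdiff μ (u := fun n => (u n)ᶜ)
    (fun a b hab => Set.compl_subset_compl.2 (hu hab)) fun n => (hm n).compl
  refine h.congr fun n => ?_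
  rw [← Set.compl_iInter]
  congr 1
  ext x
  simp only [Set.mem_sdiff, Set.mem_compl_iff]
  tauto

theorem cutWeight_iSup_le [Countable G] [MeasurableConstSMul G X] (μ : Measure X)
    [IsFiniteMeasure μ] (A : Set G) {B : Set X} (hB : MeasurableSet B) {D : ℝ} (hD : 0 ≤ D)
    (k : ℕ) {u : ℕ → ℕ → Set X} {c : ℝ} (hm : ∀ n i, MeasurableSet (u n i)) (hu : Monotone u)
    (hc : ∀ n, cutWeight μ A B D k (u n) ≤ c) : cutWeight μ A B D k (⨆ n, u n) ≤ c := by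
  have h0 : Filter.Tendsto (fun n => c + ∑ i ∈ Finset.range (k + 1), D ^ i *
      μ.real ((⋃ m, chainImage A B (u m) i) \ chainImage A B (u n) i)) Filter.atTop
      (nhds (c + ∑ i ∈ Finset.range (k + 1), D ^ i * 0)) :=
    tendsto_const_nhds.add (tendsto_finsetSum _ fun i _ => tendsto_const_nhds.mul
      (tendsto_measureReal_iUnion_sdiff μ (fun a b hab => chainImage_mono (hu hab) i)
        fun n => measurableSet_chainImage A hB (hm n) i))
  simp only [mul_zero, Finset.sum_const_zero, add_zero] at h0
  refine ge_of_tendsto' h0 fun n => ?_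
  refine le_trans ?_ (add_le_add_left (hc n) _)
  unfold cutWeight
  rw [← Finset.sum_add_distrib]
  refine Finset.sum_le_sum fun i _ => ?_
  rw [← mul_add, chainImage_iSup]
  refine mul_le_mul_of_nonneg_left ?_ (by positivity)
  refine le_trans (measureReal_mono ?_) (measureReal_union_le _ _)
  have : u n i ⊆ (⨆ n, u n) i := (le_iSup u n) i
  intro x hx
  have h2 := fun h => hx.2 (this h)
  by_cases h : x ∈ chainImage A B (u n) i
  · exact Or.inl ⟨h, h2⟩
  · exact Or.inr ⟨hx.1, h⟩

/-- Images need not commute with decreasing intersections, but monotonicity suffices: the new cut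
exceeds that of `u n` at most by `u n i \ ⋂ m, u m i`, whose measure vanishes in the limit. -/
theorem cutWeight_iInf_le (μ : Measure X)
    [IsFiniteMeasure μ] (A : Set G) {B : Set X} {D : ℝ} (hD : 0 ≤ D)
    (k : ℕ) {u : ℕ → ℕ → Set X} {c : ℝ} (hm : ∀ n i, MeasurableSet (u n i)) (hu : Antitone u)
    (hc : ∀ n, cutWeight μ A B D k (u n) ≤ c) : cutWeight μ A B D k (⨅ n, u n) ≤ c := by
  have h0 : Filter.Tendsto (fun n => c + ∑ i ∈ Finset.range (k + 1), D ^ i *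
      μ.real (u n i \ ⋂ m, u m i)) Filter.atTop
      (nhds (c + ∑ i ∈ Finset.range (k + 1), D ^ i * 0)) :=
    tendsto_const_nhds.add (tendsto_finsetSum _ fun i _ => tendsto_const_nhds.mul
      (tendsto_measureReal_sdiff_iInter μ (fun a b hab => hu hab i) fun n => hm n i))
  simp only [mul_zero, Finset.sum_const_zero, add_zero] at h0
  refine ge_of_tendsto' h0 fun n => ?_
  refine le_trans ?_ (add_le_add_left (hc n) _)
  unfold cutWeight
  rw [← Finset.sum_add_distrib]
  refine Finset.sum_le_sum fun i _ => ?_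
  rw [← mul_add]
  refine mul_le_mul_of_nonneg_left ?_ (by positivity)
  refine le_trans (measureReal_mono ?_) (measureReal_union_le _ _)
  have hi : (⨅ n, u n) i = ⋂ m, u m i := by simp
  intro x hx
  rw [hi] at hx
  have h1 := chainImage_mono (A := A) (B := B) (iInf_le u n) i hx.1
  by_cases h : x ∈ u n i
  · exact Or.inr ⟨h, hx.2⟩
  · exact Or.inl ⟨h1, h⟩

theorem exists_minimal_cutChain [Countable G] [MeasurableConstSMul G X] (μ : Measure X)
    [IsFiniteMeasure μ] (A : Set G) {B : Set X} (hB : MeasurableSet B) {D : ℝ} (hD : 0 ≤ D)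
    (k : ℕ) : ∃ R : ℕ → Set X, IsCutChain k R ∧
      ∀ R', IsCutChain k R' → cutWeight μ A B D k R ≤ cutWeight μ A B D k R' := by
  refine exists_isMinOn_of_submodular (IsCutChain k) (cutWeight μ A B D k)
    ⟨fun _ => ∅, fun _ => MeasurableSet.empty, fun _ _ => rfl⟩ (cutWeight_nonneg μ A B hD k)
    ?_ ?_ ?_ ?_ (fun R R' hR hR' => cutWeight_submodular μ A hB hD k hR.1 hR'.1)
    (fun u c hu => cutWeight_iSup_le μ A hB hD k fun n => (hu n).1)
    (fun u c hu => cutWeight_iInf_le μ A hD k fun n => (hu n).1)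
  · intro R R' hR hR'
    exact ⟨fun i => (hR.1 i).union (hR'.1 i), fun i hi => by simp [hR.2 i hi, hR'.2 i hi]⟩
  · intro R R' hR hR'
    exact ⟨fun i => (hR.1 i).inter (hR'.1 i), fun i hi => by simp [hR.2 i hi]⟩
  · intro u hu
    refine ⟨fun i => ?_, fun i hi => ?_⟩
    · simp only [iSup_apply, Set.iSup_eq_iUnion]
      exact MeasurableSet.iUnion fun n => (hu n).1 i
    · simp [(hu _).2 i hi]
  · intro u hu
    refine ⟨fun i => ?_, fun i hi => ?_⟩
    · simp only [iInf_apply, Set.iInf_eq_iInter]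
      exact MeasurableSet.iInter fun n => (hu n).1 i
    · simp [(hu _).2 i hi]

theorem IsCutChain.update {k : ℕ} {R : ℕ → Set X} (hR : IsCutChain k R) {m : ℕ} (hm : m < k)
    {Q : Set X} (hQ : MeasurableSet Q) : IsCutChain k (Function.update R m Q) := by
  refine ⟨fun i => ?_, fun i hi => ?_⟩
  · by_cases h : i = m
    · subst h; simpa using hQ
    · simpa [h] using hR.1 i
  · rw [Function.update_of_ne (by omega)]
    exact hR.2 i hi

theorem cutWeight_update (μ : Measure X) (A : Set G) (B : Set X) (D : ℝ) {k m : ℕ} (hm : m < k)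
    (R : ℕ → Set X) (Q : Set X) :
    cutWeight μ A B D k (Function.update R m Q) = cutWeight μ A B D k R +
      D ^ m * (μ.real (chainImage A B R m \ Q) - μ.real (chainImage A B R m \ R m)) +
      D ^ (m + 1) * (μ.real (A • Q \ R (m + 1)) - μ.real (A • R m \ R (m + 1))) := by
  rw [add_assoc, ← sub_eq_iff_eq_add']
  unfold cutWeight
  rw [← Finset.sum_sub_distrib]
  have hsub : ({m, m + 1} : Finset ℕ) ⊆ Finset.range (k + 1) := by
    intro i hi
    simp only [Finset.mem_insert, Finset.mem_singleton] at hi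
    simp only [Finset.mem_range]
    omega
  rw [← Finset.sum_subset hsub, Finset.sum_pair (by omega)]
  · rw [chainImage_update_of_ne A B R Q (by omega : m ≠ m + 1)]
    simp [chainImage, mul_sub]
  · intro i _ hi
    simp only [Finset.mem_insert, Finset.mem_singleton, not_or] at hi
    rw [chainImage_update_of_ne A B R Q hi.2, Function.update_of_ne hi.1, sub_self]

end Chains

/-! ### Pushing a minimal cut to the end layers -/

section Filling

variable {G X : Type*} [CommGroup G] [MeasurableSpace X] [MulAction G X] (μ : Measure X)

theorem measureReal_const_smul [SMulInvariantMeasure G X μ] (g : G) (E : Set X) : μ.real (g • E) = μ.real E := by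
  simp [Measure.real, measure_smul]

variable [Countable G] [MeasurableConstSMul G X] [IsFiniteMeasure μ]

/-- If `D * μ (A • E \ U) ≤ μ E` for every `E` in a sequence of subsets of `S`, and the reverse
inequality holds for all subsets of `S`, then the former holds for the union of the sequence. -/
theorem mul_measureReal_smul_iUnion_sdiff_le (A : Set G) {U S : Set X} (hU : MeasurableSet U)
    {D : ℝ} (hD : 0 ≤ D)
    (hS : ∀ E, MeasurableSet E → E ⊆ S → μ.real E ≤ D * μ.real (A • E \ U)) {E : ℕ → Set X}
    (hE : ∀ n, MeasurableSet (E n)) (hES : ∀ n, E n ⊆ S)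
    (h : ∀ n, D * μ.real (A • E n \ U) ≤ μ.real (E n)) :
    D * μ.real (A • (⋃ n, E n) \ U) ≤ μ.real (⋃ n, E n) := by
  have hsub : ∀ n, partialSups E n ⊆ S := fun n => partialSups_le E n S fun i _ => hES i
  have hmeas : ∀ n, MeasurableSet (partialSups E n) := by
    intro n
    induction n with
    | zero => simpa using hE 0
    | succ n ih => rw [partialSups_add_one]; exact ih.union (hE _)
  -- Uncrossing: `hS` on the intersection `V ∩ E (n + 1)` carries the bound from the two sets to
  -- their union.
  have hpart : ∀ n, D * μ.real (A • partialSups E n \ U) ≤ μ.real (partialSups E n) := by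
    intro n
    induction n with
    | zero => simpa using h 0
    | succ n ih =>
      have hsucc : partialSups E (n + 1) = partialSups E n ∪ E (n + 1) := partialSups_add_one E n
      rw [hsucc]
      have hV := hmeas n
      set V : Set X := partialSups E n
      have h1 := measureReal_union_add_inter (μ := μ) (s := V) (hE (n + 1))
      have h2 := measureReal_union_add_inter (μ := μ) (s := A • V \ U)
        ((measurableSet_smul_of_countable A (hE (n + 1))).diff hU)
      have h3 := hS (V ∩ E (n + 1)) (hV.inter (hE _)) (Set.inter_subset_left.trans (hsub n))
      have h4 : μ.real (A • (V ∩ E (n + 1)) \ U) ≤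
          μ.real ((A • V \ U) ∩ (A • E (n + 1) \ U)) := by
        refine measureReal_mono fun x hx => ?_
        exact ⟨⟨Set.smul_subset_smul_left Set.inter_subset_left hx.1, hx.2⟩,
          ⟨Set.smul_subset_smul_left Set.inter_subset_right hx.1, hx.2⟩⟩
      have h5 : A • (V ∪ E (n + 1)) \ U = (A • V \ U) ∪ (A • E (n + 1) \ U) := by
        rw [Set.smul_union, Set.union_sdiff_distrib]
      rw [h5]
      nlinarith [h (n + 1), mul_le_mul_of_nonneg_left h4 hD]
  have hunion : (⋃ n, partialSups E n) = ⋃ n, E n := iSup_partialSups_eq E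
  have hmonoA : Monotone fun n => A • partialSups E n \ U := fun a b hab =>
    Set.sdiff_subset_sdiff_left (Set.smul_subset_smul_left ((partialSups E).monotone hab))
  have ht : Filter.Tendsto (fun n => D * μ.real (A • partialSups E n \ U)) Filter.atTop
      (nhds (D * μ.real (⋃ n, A • partialSups E n \ U))) :=
    ((ENNReal.tendsto_toReal (measure_ne_top _ _)).comp
      (tendsto_measure_iUnion_atTop hmonoA)).const_mul D
  rw [← Set.iUnion_sdiff, ← Set.smul_iUnion, hunion] at ht
  refine le_of_tendsto' ht fun n => (hpart n).trans (measureReal_mono ?_)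
  rw [← hunion]
  exact Set.subset_iUnion (fun n => (partialSups E n : Set X)) n

variable [SMulInvariantMeasure G X μ]

/-- If the set `S = A • Q \ U` satisfies the two Hall-type conditions `hup` and `hdown`, then the
upper one is tight on the whole of `S`. Commutativity of the group enters here. -/
theorem mul_measureReal_smul_sdiff_le (A : Set G) {Q U : Set X} (hQ : MeasurableSet Q)
    (hU : MeasurableSet U) {D : ℝ} (hD : 0 ≤ D)
    (hup : ∀ E, MeasurableSet E → E ⊆ A • Q \ U → μ.real E ≤ D * μ.real (A • E \ A • U))
    (hdown : ∀ E, MeasurableSet E → E ⊆ A • Q \ U → D * μ.real E ≤ μ.real (A⁻¹ • E ∩ Q)) :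
    D * μ.real (A • (A • Q \ U) \ A • U) ≤ μ.real (A • Q \ U) := by
  rcases A.eq_empty_or_nonempty with rfl | hA
  · simp
  obtain ⟨f, rfl⟩ := (A.to_countable).exists_eq_range hA
  set A := Set.range f with hAdef
  have hfA : ∀ n, f n ∈ A := fun n => ⟨n, rfl⟩
  set S := A • Q \ U with hS
  have hSm : MeasurableSet S := (measurableSet_smul_of_countable A hQ).diff hU
  have hAU : MeasurableSet (A • U) := measurableSet_smul_of_countable A hU
  have hunion : (⋃ n, S ∩ f n • Q) = S := by
    rw [← Set.inter_iUnion]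
    refine Set.inter_eq_left.2 fun x hx => ?_
    obtain ⟨a, ⟨n, rfl⟩, q, hq, rfl⟩ := hx.1
    exact Set.mem_iUnion.2 ⟨n, Set.smul_mem_smul_set hq⟩
  have hmain := mul_measureReal_smul_iUnion_sdiff_le μ A hAU hD hup
    (E := fun n => S ∩ f n • Q) (fun n => hSm.inter (hQ.const_smul _))
    (fun n => Set.inter_subset_left) ?_
  · rwa [hunion] at hmain
  intro n
  set a := f n
  have ha : a ∈ A := hfA n
  set T := A • S \ A • U with hT
  have hTm : MeasurableSet T := (measurableSet_smul_of_countable A hSm).diff hAU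
  have hE : MeasurableSet (S ∩ a⁻¹ • T) := hSm.inter (hTm.const_smul _)
  -- By commutativity `b • a • q = a • b • q`, and `b • q` lies in `S`, being outside `U`. This and
  -- `h2` enclose `S ∩ a • Q` so that `hdown` yields the bound on each piece of the cover of `S`.
  have h1 : A • (S ∩ a • Q) \ A • U ⊆ a • (S ∩ a⁻¹ • T) := by
    rintro _ ⟨⟨b, hb, _, ⟨hs, q, hq, rfl⟩, rfl⟩, hU'⟩
    simp only [] at hs hU' ⊢
    have hcomm : b • a • q = a • b • q := smul_comm b a q
    have hbq : b • q ∉ U := fun hmem => hU' ⟨a, ha, b • q, hmem, hcomm.symm⟩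
    refine ⟨b • q, ⟨⟨⟨b, hb, q, hq, rfl⟩, hbq⟩, ?_⟩, hcomm.symm⟩
    rw [Set.mem_inv_smul_set_iff, ← hcomm]
    exact ⟨⟨b, hb, a • q, hs, rfl⟩, hU'⟩
  have h2 : A⁻¹ • (S ∩ a⁻¹ • T) ∩ Q ⊆ a⁻¹ • (S ∩ a • Q) := by
    rintro _ ⟨⟨b, hb, s, ⟨hs, hsT⟩, rfl⟩, hq⟩
    simp only [] at hq ⊢
    rw [Set.mem_inv_smul_set_iff] at hsT ⊢
    refine ⟨⟨⟨a, ha, b • s, hq, rfl⟩, fun hmem => hsT.2 ?_⟩, Set.smul_mem_smul_set hq⟩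
    refine ⟨b⁻¹, hb, a • b • s, hmem, ?_⟩
    simp only []
    rw [smul_comm a b s, inv_smul_smul]
  calc D * μ.real (A • (S ∩ a • Q) \ A • U)
      ≤ D * μ.real (a • (S ∩ a⁻¹ • T)) := mul_le_mul_of_nonneg_left (measureReal_mono h1) hD
    _ = D * μ.real (S ∩ a⁻¹ • T) := by rw [measureReal_const_smul]
    _ ≤ μ.real (A⁻¹ • (S ∩ a⁻¹ • T) ∩ Q) := hdown _ hE Set.inter_subset_left
    _ ≤ μ.real (a⁻¹ • (S ∩ a • Q)) := measureReal_mono h2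
    _ = μ.real (S ∩ a • Q) := measureReal_const_smul μ _ _

/-- Minimality under two perturbations supplies the Hall-type conditions: enlarging `R (m + 1)` by
`E` gives `hup`, removing `A⁻¹ • E` from `R m` gives `hdown`. Tightness then says that the saving in
layer `m + 1` pays for the growth in layer `m + 2`. -/
theorem cutWeight_fill_le (A : Set G) {B : Set X} {D : ℝ} (hD : 0 < D) {k m : ℕ}
    (hm : m + 1 < k) {R : ℕ → Set X} (hR : IsCutChain k R)
    (hmin : ∀ R', IsCutChain k R' → cutWeight μ A B D k R ≤ cutWeight μ A B D k R') :
    cutWeight μ A B D k (Function.update R (m + 1) (R (m + 1) ∪ A • R m))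
      ≤ cutWeight μ A B D k R := by
  have hAR : ∀ i, MeasurableSet (A • R i) := fun i => measurableSet_smul_of_countable A (hR.1 i)
  have hgrow : ∀ E : Set X, μ.real (A • (R (m + 1) ∪ E) \ R (m + 2)) ≤
      μ.real (A • R (m + 1) \ R (m + 2)) + μ.real (A • E \ A • R (m + 1)) := by
    intro E
    refine le_trans (measureReal_mono ?_) (measureReal_union_le _ _)
    rw [Set.smul_union]
    intro x hx
    by_cases h : x ∈ A • R (m + 1)
    · exact Or.inl ⟨h, hx.2⟩
    · exact Or.inr ⟨hx.1.resolve_left h, h⟩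
  have hup : ∀ E, MeasurableSet E → E ⊆ A • R m \ R (m + 1) →
      μ.real E ≤ D * μ.real (A • E \ A • R (m + 1)) := by
    intro E hE hES
    have h := hmin _ (hR.update hm ((hR.1 (m + 1)).union hE))
    rw [cutWeight_update μ A B D hm] at h
    have h1 : μ.real (A • R m \ (R (m + 1) ∪ E)) = μ.real (A • R m \ R (m + 1)) - μ.real E := by
      rw [← Set.sdiff_sdiff, measureReal_sdiff hES hE]
    have h2 := hgrow E
    simp only [chainImage] at h
    rw [h1, pow_succ D (m + 1)] at h
    have hp : 0 < D ^ (m + 1) := by positivity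
    have h3 : 0 ≤ D ^ (m + 1) * (D * μ.real (A • E \ A • R (m + 1)) - μ.real E) := by
      have := mul_le_mul_of_nonneg_left h2 (mul_pos hp hD).le
      linarith
    linarith [nonneg_of_mul_nonneg_right h3 hp]
  have hdown : ∀ E, MeasurableSet E → E ⊆ A • R m \ R (m + 1) →
      D * μ.real E ≤ μ.real (A⁻¹ • E ∩ R m) := by
    intro E hE hES
    have hN : MeasurableSet (A⁻¹ • E) := measurableSet_smul_of_countable _ hE
    have h := hmin _ (hR.update (by omega : m < k) ((hR.1 m).diff hN))
    rw [cutWeight_update μ A B D (by omega : m < k)] at h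
    have h1 : μ.real (chainImage A B R m \ (R m \ A⁻¹ • E)) ≤
        μ.real (chainImage A B R m \ R m) + μ.real (A⁻¹ • E ∩ R m) := by
      refine le_trans (measureReal_mono ?_) (measureReal_union_le _ _)
      intro x hx
      simp only [Set.mem_sdiff, Set.mem_union, Set.mem_inter_iff] at hx ⊢
      tauto
    have h2 : μ.real (A • (R m \ A⁻¹ • E) \ R (m + 1)) ≤
        μ.real (A • R m \ R (m + 1)) - μ.real E := by
      rw [← measureReal_sdiff hES hE]
      refine measureReal_mono ?_
      rintro _ ⟨⟨b, hb, r, hr, rfl⟩, hx⟩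
      refine ⟨⟨⟨b, hb, r, hr.1, rfl⟩, hx⟩, fun hmem => hr.2 ?_⟩
      exact ⟨b⁻¹, Set.inv_mem_inv.2 hb, b • r, hmem, inv_smul_smul b r⟩
    have hp : 0 < D ^ m := by positivity
    rw [pow_succ] at h
    have h3 : 0 ≤ D ^ m * (μ.real (A⁻¹ • E ∩ R m) - D * μ.real E) := by
      have := mul_le_mul_of_nonneg_left h1 hp.le
      have := mul_le_mul_of_nonneg_left h2 (mul_pos hp hD).le
      linarith
    linarith [nonneg_of_mul_nonneg_right h3 hp]
  have key := mul_measureReal_smul_sdiff_le μ A (hR.1 m) (hR.1 (m + 1)) hD.le hup hdown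
  have heq : R (m + 1) ∪ A • R m = R (m + 1) ∪ (A • R m \ R (m + 1)) :=
    Set.union_sdiff_self.symm
  have h2 := hgrow (A • R m \ R (m + 1))
  rw [← heq] at h2
  rw [cutWeight_update μ A B D hm]
  simp only [chainImage]
  have h0 : A • R m \ (R (m + 1) ∪ A • R m) = ∅ :=
    Set.sdiff_eq_empty.2 Set.subset_union_right
  rw [h0, measureReal_empty, pow_succ D (m + 1)]
  have hp : 0 < D ^ (m + 1) := by positivity
  have h3 := mul_le_mul_of_nonneg_left h2 (mul_pos hp hD).le
  have h4 := mul_le_mul_of_nonneg_left key hp.le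
  linarith

theorem exists_minimal_cutChain_filled (A : Set G) {B : Set X} (hB : MeasurableSet B) {D : ℝ}
    (hD : 0 < D) (k n : ℕ) : ∃ R : ℕ → Set X, IsCutChain k R ∧
      (∀ R', IsCutChain k R' → cutWeight μ A B D k R ≤ cutWeight μ A B D k R') ∧
      ∀ i < n, i + 1 < k → A • R i ⊆ R (i + 1) := by
  induction n with
  | zero =>
    obtain ⟨R, h1, h2⟩ := exists_minimal_cutChain μ A hB hD.le k
    exact ⟨R, h1, h2, fun i hi => absurd hi (Nat.not_lt_zero i)⟩
  | succ n ih =>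
    obtain ⟨R, h1, h2, h3⟩ := ih
    by_cases hn : n + 1 < k
    · refine ⟨Function.update R (n + 1) (R (n + 1) ∪ A • R n), h1.update hn
        ((h1.1 _).union (measurableSet_smul_of_countable A (h1.1 n))), fun R' hR' =>
        (cutWeight_fill_le μ A hD hn h1 h2).trans (h2 R' hR'), fun i hi hik => ?_⟩
      -- Only `R (n + 1)` grows, so the inclusions for `i < n` survive.
      rw [Function.update_of_ne (by omega : i ≠ n + 1)]
      rcases Nat.lt_succ_iff_lt_or_eq.1 hi with h | rfl
      · rw [Function.update_of_ne (by omega : i + 1 ≠ n + 1)]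
        exact h3 i h hik
      · rw [Function.update_self]
        exact Set.subset_union_right
    · exact ⟨R, h1, h2, fun i hi hik => h3 i (by omega) hik⟩

/-- Plünnecke's inequality for measure preserving actions: if every measurable `Z ⊆ B` satisfies
`μ Z ≤ D ^ k * μ (A ^ k • Z)`, then `μ B ≤ D ^ j * μ (A ^ j • B)` for `j ≤ k`. -/
theorem measureReal_le_pow_mul_measureReal_pow_smul (A : Set G) {B : Set X}
    (hB : MeasurableSet B) {D : ℝ} (hD : 0 < D) {j k : ℕ} (hj : 1 ≤ j) (hjk : j ≤ k)
    (h : ∀ Z, MeasurableSet Z → Z ⊆ B → μ.real Z ≤ D ^ k * μ.real (A ^ k • Z)) :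
    μ.real B ≤ D ^ j * μ.real (A ^ j • B) := by
  obtain ⟨R, hR, hmin, hfill⟩ := exists_minimal_cutChain_filled μ A hB hD k k
  -- `R 0` need not lie in `B`, hence the intersection.
  have hpow : ∀ i < k, A ^ i • (R 0 ∩ B) ⊆ R i := by
    intro i
    induction i with
    | zero => intro _; simp
    | succ i ih =>
      intro hi
      rw [pow_succ', mul_smul]
      exact (Set.smul_subset_smul_left (ih (by omega))).trans (hfill i (by omega) hi)
  have hlow : μ.real B ≤ cutWeight μ A B D k R := by
    obtain ⟨k, rfl⟩ : ∃ k', k = k' + 1 := ⟨k - 1, by omega⟩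
    unfold cutWeight
    rw [Finset.sum_range_succ, Finset.sum_range_succ']
    have h1 : μ.real (R 0 ∩ B) ≤ D ^ (k + 1) * μ.real (A • R k \ R (k + 1)) := by
      refine (h _ ((hR.1 0).inter hB) Set.inter_subset_right).trans
        (mul_le_mul_of_nonneg_left (measureReal_mono ?_) (by positivity))
      rw [hR.2 (k + 1) le_rfl, Set.sdiff_empty, pow_succ', mul_smul]
      exact Set.smul_subset_smul_left (hpow k (by omega))
    have h2 : μ.real B = μ.real (B \ R 0) + μ.real (R 0 ∩ B) := by
      rw [Set.inter_comm, add_comm, measureReal_inter_add_sdiff (hR.1 0)]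
    have h3 : 0 ≤ ∑ i ∈ Finset.range k,
        D ^ (i + 1) * μ.real (chainImage A B R (i + 1) \ R (i + 1)) :=
      Finset.sum_nonneg fun _ _ => by positivity
    simp only [chainImage, pow_zero, one_mul] at h3 ⊢
    linarith
  -- The competing chain cuts exactly the whole of layer `j`.
  refine hlow.trans ((hmin (fun i => if i < j then A ^ i • B else ∅) ⟨fun i => ?_,
    fun i hi => if_neg (by omega)⟩).trans (le_of_eq ?_))
  · dsimp only
    split_ifs
    · exact measurableSet_smul_of_countable _ hB
    · exact MeasurableSet.empty
  · unfold cutWeight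
    rw [Finset.sum_eq_single_of_mem j (Finset.mem_range.2 (by omega))]
    · obtain ⟨j, rfl⟩ : ∃ j', j = j' + 1 := ⟨j - 1, by omega⟩
      simp [chainImage, pow_succ', mul_smul]
    · intro i _ hij
      rcases i with _ | i
      · simp [chainImage, show 0 < j by omega]
      · by_cases hi : i + 1 < j
        · simp [chainImage, hi, show i < j by omega, pow_succ', mul_smul]
        · simp [chainImage, show ¬ i < j by omega]

end Filling

/-! ### Magnification ratios -/

theorem magnificationRatio_le {G X : Type*} [SMul G X] [MeasurableSpace X] (μ : Measure X)
    (A : Set G) {B B' : Set X} (hm : MeasurableSet B') (hB' : B' ⊆ B) (h0 : 0 < μ B') :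
    magnificationRatio μ A B ≤ μ (A • B') / μ B' :=
  iInf_le_of_le B' (iInf_le_of_le hm (iInf_le_of_le hB' (iInf_le_of_le h0 le_rfl)))

theorem magnificationRatio_pow_rpow_le {G X : Type*} [CommGroup G] [Countable G]
    [MeasurableSpace X] [MulAction G X] [MeasurableConstSMul G X] (μ : Measure X)
    [IsFiniteMeasure μ] [SMulInvariantMeasure G X μ] (A : Set G) (B : Set X) {j k : ℕ}
    (hj : 1 ≤ j) (hjk : j ≤ k) :
    magnificationRatio μ (A ^ k) B ^ ((j : ℝ) / k) ≤ magnificationRatio μ (A ^ j) B := by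
  have hj0 : (0 : ℝ) < j := by exact_mod_cast hj
  have hk0 : (0 : ℝ) < k := by exact_mod_cast hj.trans hjk
  refine le_iInf fun B' => le_iInf fun hm => le_iInf fun hB' => le_iInf fun h0 => ?_
  rcases eq_or_ne (magnificationRatio μ (A ^ k) B) 0 with hc0 | hc0
  · rw [hc0, ENNReal.zero_rpow_of_pos (by positivity)]
    exact zero_le
  have hct : magnificationRatio μ (A ^ k) B ≠ ⊤ :=
    ((magnificationRatio_le μ (A ^ k) hm hB' h0).trans_lt
      (ENNReal.div_lt_top (measure_ne_top _ _) h0.ne')).ne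
  set c := magnificationRatio μ (A ^ k) B with hc
  set l := c.toReal with hl
  have hl0 : 0 < l := ENNReal.toReal_pos hc0 hct
  -- With `D ^ k = 1 / l`, the hypothesis of Plünnecke's inequality for `B'` is the definition of
  -- `c`, as subsets of `B'` are subsets of `B`.
  set D : ℝ := (l ^ (1 / (k : ℝ)))⁻¹ with hD
  have hDpow : ∀ n : ℕ, D ^ n = (l ^ ((n : ℝ) / k))⁻¹ := by
    intro n
    rw [hD, inv_pow, ← Real.rpow_mul_natCast hl0.le, one_div_mul_eq_div]
  have hmain := measureReal_le_pow_mul_measureReal_pow_smul μ A hm (D := D)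
    (by positivity) hj hjk fun Z hZ hZB => by
      rw [hDpow, div_self hk0.ne', Real.rpow_one, ← div_eq_inv_mul, le_div_iff₀ hl0]
      rcases eq_or_ne (μ Z) 0 with hZ0 | hZ0
      · simp [Measure.real, hZ0]
      have h1 := magnificationRatio_le μ (A ^ k) hZ (hZB.trans hB') (pos_iff_ne_zero.2 hZ0)
      rw [ENNReal.le_div_iff_mul_le (Or.inl hZ0) (Or.inl (measure_ne_top _ _))] at h1
      have h2 := ENNReal.toReal_mono (measure_ne_top _ _) h1
      rwa [ENNReal.toReal_mul, mul_comm] at h2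
  rw [hDpow, ← div_eq_inv_mul, le_div_iff₀ (by positivity)] at hmain
  rw [ENNReal.le_div_iff_mul_le (Or.inl h0.ne') (Or.inl (measure_ne_top _ _)),
    ← ENNReal.toReal_le_toReal (ENNReal.mul_ne_top
      (ENNReal.rpow_ne_top_of_nonneg (by positivity) hct) (measure_ne_top _ _))
      (measure_ne_top _ _), ENNReal.toReal_mul, ← ENNReal.toReal_rpow, mul_comm]
  exact hmain

theorem mainTheorem6 {G X : Type*} [CommGroup G] [Countable G] [MeasurableSpace X]
    [MulAction G X] [MeasurableConstSMul G X]
    (μ : Measure X) [IsProbabilityMeasure μ] [SMulInvariantMeasure G X μ]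
    (hL2 : TopologicalSpace.SeparableSpace (Lp ℝ 2 μ))
    (A : Set G) (B : Set X) (hB : MeasurableSet B) (hB0 : 0 < μ B)
    (j k : ℕ) (hj : 1 ≤ j) (hjk : j ≤ k) :
    magnificationRatio μ (A ^ k) B ^ (1 / (k : ℝ))
        ≤ magnificationRatio μ (A ^ j) B ^ (1 / (j : ℝ)) ∧
      magnificationRatio μ (A ^ j) B ^ (1 / (j : ℝ))
        ≤ (μ ((A ^ j) • B) / μ B) ^ (1 / (j : ℝ)) := by
  have hj0 : (0 : ℝ) < j := by exact_mod_cast hj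
  refine ⟨?_, ENNReal.rpow_le_rpow (magnificationRatio_le μ (A ^ j) hB subset_rfl hB0)
    (by positivity)⟩
  have h := ENNReal.rpow_le_rpow (magnificationRatio_pow_rpow_le μ A B hj hjk)
    (by positivity : (0 : ℝ) ≤ 1 / j)
  rwa [← ENNReal.rpow_mul, div_mul_div_comm, mul_one, mul_comm (k : ℝ), ← div_div,
    div_self hj0.ne'] at h
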